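/- Let $D\ge 0$ be a fixed integer. Let $\mathbb{B}^D=\{x\in\mathbb{R}^D:\|x\|<1\}$ be the Poincaré ball model of $D$-dimensional hyperbolic space, with the hyperbolic distance $$d_H(u,v)=\operatorname{arcosh}\left(1+\frac{2\|u-v\|^2}{(1-\|u\|^2)(1-\|v\|^2)}\right),$$ and for a nonempty finite set $P\subset\mathbb{B}^D$ and $q\in\mathbb{B}^D$ let $f_P(q)$ denote a point of $P$ that is farthest from $q$, so that $d_H(q,f_P(q))=\max_{p\in P}d_H(q,p)$. There are a constant $C$ and a real-RAM program, both depending only on $D$, with the following property. (The real RAM works with natural numbers, which can be added, subtracted and compared and used as addresses, and with real numbers, on which $+,-,\times,/,\sqrt{\cdot}$ and comparison are available; each elementary operation takes one unit of time.) Let $P=\{p_1,\dots,p_n\}$ be a set of $n\ge 1$ points of $\mathbb{B}^D$ such that $\Delta_1=d_H(p_1,f_P(p_1))$ satisfies $\Delta_1\ge 5$, and let $0<\varepsilon<1$. On input $n,\varepsilon,p_1,\dots,p_n$ the program halts after at most $C\,n/\varepsilon^D$ steps, and it outputs a list of at most $C/\varepsilon^D$ indices describing a subset $P_\varepsilon\subset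 P$ (a coreset for farthest-point queries) of size $|P_\varepsilon|\le C/\varepsilon^D$, such that for every query point $q\in\mathbb{B}^D$ there is a point $p_\varepsilon\in P_\varepsilon$ with $$d_H(q,p_\varepsilon)\ \ge\ d_H(q,f_P(q))-\varepsilon .$$ -/

import Mathlib

/-- The open unit ball of `ℝ^D` with its Euclidean norm, carrier of the Poincaré ball model. -/
abbrev PBall (D : ℕ) : Type := Metric.ball (0 : EuclideanSpace ℝ (Fin D)) 1

/-- The hyperbolic distance of the Poincaré ball model. -/
noncomputable def hypDist {D : ℕ} (u v : PBall D) : ℝ :=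
  Real.arcosh (1 + 2 * ‖u.1 - v.1‖ ^ 2 / ((1 - ‖u.1‖ ^ 2) * (1 - ‖v.1‖ ^ 2)))

/-- `a` is one of the points of the finite family `P`, and no point of `P` is farther from `q`. -/
def IsFarthestPoint {D n : ℕ} (P : Fin n → PBall D) (q a : PBall D) : Prop :=
  a ∈ Set.range P ∧ ∀ i, hypDist q (P i) ≤ hypDist q a

/-! ### A real RAM

The memory consists of arrays of natural numbers and arrays of real numbers; a program mentions
finitely many of them by name, and may address their cells indirectly. Natural numbers can be
added, subtracted and compared; real numbers can be added, subtracted, multiplied, divided and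
compared, and square roots can be taken. There is no rounding of reals to integers. Every
elementary operation, memory access, constant, comparison and branch costs one unit of time. -/

namespace RealRAM

/-- A memory: `s.nat a i` and `s.real a i` are the cells with index `i` of the arrays named `a`. -/
structure Memory where
  nat : ℕ → ℕ → ℕ
  real : ℕ → ℕ → ℝ

/-- Expressions for natural numbers; `sub` is truncated subtraction. -/
inductive NatExpr : Type
  | const (c : ℕ)
  | read (a : ℕ) (i : NatExpr)
  | add (x y : NatExpr)
  | sub (x y : NatExpr)

/-- Expressions for real numbers; the only constants are rational. -/
inductive RealExpr : Type
  | const (c : ℚ)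
  | read (a : ℕ) (i : NatExpr)
  | add (x y : RealExpr)
  | sub (x y : RealExpr)
  | mul (x y : RealExpr)
  | div (x y : RealExpr)
  | sqrt (x : RealExpr)

/-- Tests. -/
inductive Test : Type
  | natLt (x y : NatExpr)
  | realLt (x y : RealExpr)
  | not (b : Test)

/-- Programs. `setNat a i x` stores the value of `x` in the cell of index `i` of the
natural-number array `a`, and `setReal` does the same for real arrays. -/
inductive Prog : Type
  | skip
  | setNat (a : ℕ) (i : NatExpr) (x : NatExpr)
  | setReal (a : ℕ) (i : NatExpr) (x : RealExpr)
  | seq (p q : Prog)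
  | ite (b : Test) (p q : Prog)
  | while (b : Test) (p : Prog)

namespace NatExpr

def eval (s : Memory) : NatExpr → ℕ
  | const c => c
  | read a i => s.nat a (i.eval s)
  | add x y => x.eval s + y.eval s
  | sub x y => x.eval s - y.eval s

def cost : NatExpr → ℕ
  | const _ => 1
  | read _ i => i.cost + 1
  | add x y => x.cost + y.cost + 1
  | sub x y => x.cost + y.cost + 1

end NatExpr

namespace RealExpr

noncomputable def eval (s : Memory) : RealExpr → ℝ
  | const c => (c : ℝ)
  | read a i => s.real a (i.eval s)
  | add x y => x.eval s + y.eval s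
  | sub x y => x.eval s - y.eval s
  | mul x y => x.eval s * y.eval s
  | div x y => x.eval s / y.eval s
  | sqrt x => Real.sqrt (x.eval s)

def cost : RealExpr → ℕ
  | const _ => 1
  | read _ i => i.cost + 1
  | add x y => x.cost + y.cost + 1
  | sub x y => x.cost + y.cost + 1
  | mul x y => x.cost + y.cost + 1
  | div x y => x.cost + y.cost + 1
  | sqrt x => x.cost + 1

end RealExpr

namespace Test

def Holds (s : Memory) : Test → Prop
  | natLt x y => x.eval s < y.eval s
  | realLt x y => x.eval s < y.eval s
  | not b => ¬ b.Holds s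

def cost : Test → ℕ
  | natLt x y => x.cost + y.cost + 1
  | realLt x y => x.cost + y.cost + 1
  | not b => b.cost + 1

end Test

/-- The memory after storing `v` in cell `i` of the natural-number array `a`. -/
def Memory.updateNat (s : Memory) (a i v : ℕ) : Memory where
  nat := Function.update s.nat a (Function.update (s.nat a) i v)
  real := s.real

/-- The memory after storing `v` in cell `i` of the real array `a`. -/
noncomputable def Memory.updateReal (s : Memory) (a i : ℕ) (v : ℝ) : Memory where
  nat := s.nat
  real := Function.update s.real a (Function.update (s.real a) i v)

/-- `Exec p s t s'`: started on the memory `s`, the program `p` halts after exactly `t` units of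
time, leaving the memory `s'`. -/
inductive Exec : Prog → Memory → ℕ → Memory → Prop
  | skip (s : Memory) : Exec .skip s 1 s
  | setNat (s : Memory) (a : ℕ) (i x : NatExpr) :
      Exec (.setNat a i x) s (i.cost + x.cost + 1) (s.updateNat a (i.eval s) (x.eval s))
  | setReal (s : Memory) (a : ℕ) (i : NatExpr) (x : RealExpr) :
      Exec (.setReal a i x) s (i.cost + x.cost + 1) (s.updateReal a (i.eval s) (x.eval s))
  | seq {p q : Prog} {s s' s'' : Memory} {t t' : ℕ} :
      Exec p s t s' → Exec q s' t' s'' → Exec (.seq p q) s (t + t') s''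
  | iteTrue {b : Test} {p q : Prog} {s s' : Memory} {t : ℕ} :
      b.Holds s → Exec p s t s' → Exec (.ite b p q) s (b.cost + 1 + t) s'
  | iteFalse {b : Test} {p q : Prog} {s s' : Memory} {t : ℕ} :
      ¬ b.Holds s → Exec q s t s' → Exec (.ite b p q) s (b.cost + 1 + t) s'
  | whileTrue {b : Test} {p : Prog} {s s' s'' : Memory} {t t' : ℕ} :
      b.Holds s → Exec p s t s' → Exec (.while b p) s' t' s'' →
        Exec (.while b p) s (b.cost + 1 + t + t') s''
  | whileFalse {b : Test} {p : Prog} {s : Memory} :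
      ¬ b.Holds s → Exec (.while b p) s (b.cost + 1) s

end RealRAM

/-- The initial memory for an input `P = (p_0, …, p_{n-1})`, `ε`: the number `n` is in the
natural-number array `0`, the number `ε` is in the real array `0`, the `j`-th coordinates of the
points are in the real array `j + 1`, and all other cells are zero. -/
noncomputable def coresetInput {D n : ℕ} (P : Fin n → PBall D) (ε : ℝ) : RealRAM.Memory where
  nat := fun a i => if a = 0 ∧ i = 0 then n else 0
  real := fun a i =>
    match a with
    | 0 => if i = 0 then ε else 0
    | j + 1 => if h : j < D ∧ i < n then (P ⟨i, h.2⟩).1 ⟨j, h.1⟩ else 0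

/-- The final memory `s` describes the set `S` of points by a list of `k` indices of points of
`P`: the number `k` is in the natural-number array `1`, the indices are in the array `2`. -/
def CoresetOutput {D n : ℕ} (P : Fin n → PBall D) (s : RealRAM.Memory) (k : ℕ)
    (S : Finset (PBall D)) : Prop :=
  s.nat 1 0 = k ∧
    ∃ idx : Fin k → Fin n, (∀ i : Fin k, s.nat 2 i = idx i) ∧ (S : Set (PBall D)) = Set.range (P ∘ idx)

/-! In the hyperboloid model, `cosh d_H` is the bilinear Lorentz form, so farthest-point queries
maximize a linear functional. Let `a` be farthest from the first point and `b` farthest from `a`,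
let `m` be the midpoint of `a` and `b`, and put `G = cosh (d_H(a,b)/2)`. Use the coordinates of the
frame boosted to `m`.

Size: `coshDist_le_of_farthest` and `norm_boost_le` place all spatial parts in a Euclidean ball of
radius `5 * G`. By `card_le_of_separated`, a family separated by `ε * G / 8` in that ball has
`O(1/ε^D)` members, since `G` cancels. The coreset is such a family, chosen greedily and maximal.

Quality: a query `q` at distance `r` from `m` has time coordinate `cosh r` and a spatial part of
norm at most `cosh r`. Moving `p` by `ε * G / 8` in the frame therefore changes `cosh d_H(q,p)` by
at most `ε * G * cosh r / 4`. Because `G * cosh r` is the mean of `cosh d_H(q,a)` and `cosh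
d_H(q,b)`, this is at most `ε/4` times the maximum (`coshDist_ge_of_close`). A relative loss `ε/4`
in `cosh` is an additive loss at most `ε` in distance once `cosh` is at least `3` (`arcosh_sub_le`),
which `Δ₁ ≥ 5` ensures.

Time: all comparisons are rational in the coordinates and `ε`, and each of the `n` points is
compared with at most `O(1/ε^D)` selected ones (`coresetProg_runs`). -/

/-! ### Lorentz form and boosted frames. -/

section Lorentz

variable {E : Type*} [NormedAddCommGroup E] [InnerProductSpace ℝ E]

/-- The Lorentz form on `ℝ × E`, positive on the time axis. -/
noncomputable def lorentz (x y : ℝ × E) : ℝ := x.1 * y.1 - inner ℝ x.2 y.2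

/-- The spatial part of `x` in the frame obtained by boosting the time axis to `m`. -/
noncomputable def boost (m x : ℝ × E) : E := x.2 + (inner ℝ x.2 m.2 / (1 + m.1) - x.1) • m.2

lemma lorentz_comm (x y : ℝ × E) : lorentz x y = lorentz y x := by
  simp only [lorentz, real_inner_comm, mul_comm]

lemma lorentz_add_right (x y z : ℝ × E) : lorentz x (y + z) = lorentz x y + lorentz x z := by
  simp only [lorentz, Prod.fst_add, Prod.snd_add, inner_add_right]; ring

lemma lorentz_sub_right (x y z : ℝ × E) : lorentz x (y - z) = lorentz x y - lorentz x z := by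
  simp only [lorentz, Prod.fst_sub, Prod.snd_sub, inner_sub_right]; ring

lemma lorentz_smul_right (c : ℝ) (x y : ℝ × E) : lorentz x (c • y) = c * lorentz x y := by
  simp only [lorentz, Prod.smul_fst, Prod.smul_snd, inner_smul_right, smul_eq_mul]; ring

lemma lorentz_add_left (x y z : ℝ × E) : lorentz (x + y) z = lorentz x z + lorentz y z := by
  rw [lorentz_comm, lorentz_add_right, lorentz_comm z x, lorentz_comm z y]

lemma lorentz_sub_left (x y z : ℝ × E) : lorentz (x - y) z = lorentz x z - lorentz y z := by
  rw [lorentz_comm, lorentz_sub_right, lorentz_comm z x, lorentz_comm z y]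

lemma lorentz_smul_left (c : ℝ) (x y : ℝ × E) : lorentz (c • x) y = c * lorentz x y := by
  rw [lorentz_comm, lorentz_smul_right, lorentz_comm]

lemma boost_sub (m x y : ℝ × E) : boost m (x - y) = boost m x - boost m y := by
  simp only [boost, Prod.fst_sub, Prod.snd_sub, inner_sub_left, sub_div, sub_smul]; abel

/-- A boost preserves the Lorentz form, and the time coordinate of `x` in the frame of `m` is
`lorentz x m`; what remains of the form is minus the spatial inner product. -/
lemma inner_boost {m : ℝ × E} (hm : lorentz m m = 1) (hm0 : 0 < m.1) (x y : ℝ × E) :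
    inner ℝ (boost m x) (boost m y) = lorentz x m * lorentz y m - lorentz x y := by
  have h1 : (1 : ℝ) + m.1 ≠ 0 := by positivity
  have hmm : inner ℝ m.2 m.2 = m.1 ^ 2 - 1 := by
    simp only [lorentz] at hm; linarith
  simp only [boost, lorentz, inner_add_left, inner_add_right, inner_smul_left, inner_smul_right,
    hmm, RCLike.conj_to_real, real_inner_comm y.2 m.2]
  field_simp
  ring

lemma norm_boost_sq {m : ℝ × E} (hm : lorentz m m = 1) (hm0 : 0 < m.1) (x : ℝ × E) :
    ‖boost m x‖ ^ 2 = lorentz x m ^ 2 - lorentz x x := by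
  rw [← real_inner_self_eq_norm_sq, inner_boost hm hm0]; ring

lemma abs_lorentz_le {m : ℝ × E} (hm : lorentz m m = 1) (hm0 : 0 < m.1) (q y : ℝ × E) :
    |lorentz q y| ≤ |lorentz q m| * |lorentz y m| + ‖boost m q‖ * ‖boost m y‖ := by
  have h := inner_boost hm hm0 q y
  have h2 := abs_real_inner_le_norm (boost m q) (boost m y)
  have h3 : lorentz q y = lorentz q m * lorentz y m - inner ℝ (boost m q) (boost m y) := by
    linarith
  rw [h3, ← abs_mul]
  exact (abs_sub _ _).trans (by gcongr)

end Lorentz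

/-! ### Hyperbolic cosine of the distance. -/

section CoshDist

variable {E : Type*} [NormedAddCommGroup E]

/-- The hyperbolic cosine of the hyperbolic distance, as a rational function. -/
noncomputable def coshDist (u v : E) : ℝ :=
  1 + 2 * ‖u - v‖ ^ 2 / ((1 - ‖u‖ ^ 2) * (1 - ‖v‖ ^ 2))

lemma one_sub_normSq_pos {u : E} (hu : ‖u‖ < 1) : 0 < 1 - ‖u‖ ^ 2 := by
  nlinarith [norm_nonneg u]

lemma one_le_coshDist {u v : E} (hu : ‖u‖ < 1) (hv : ‖v‖ < 1) : 1 ≤ coshDist u v := by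
  have := one_sub_normSq_pos hu
  have := one_sub_normSq_pos hv
  have : 0 ≤ 2 * ‖u - v‖ ^ 2 / ((1 - ‖u‖ ^ 2) * (1 - ‖v‖ ^ 2)) := by positivity
  unfold coshDist; linarith

lemma coshDist_comm (u v : E) : coshDist u v = coshDist v u := by
  rw [coshDist, coshDist, norm_sub_rev, mul_comm (1 - ‖u‖ ^ 2)]

lemma coshDist_self (u : E) : coshDist u u = 1 := by simp [coshDist]

/-- The hyperbolic cosine of half the distance of `a` and `b`. -/
noncomputable def coshHalf (a b : E) : ℝ := √((1 + coshDist a b) / 2)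

lemma coshHalf_sq {a b : E} (ha : ‖a‖ < 1) (hb : ‖b‖ < 1) :
    coshHalf a b ^ 2 = (1 + coshDist a b) / 2 :=
  Real.sq_sqrt (by linarith [one_le_coshDist ha hb])

lemma coshHalf_pos {a b : E} (ha : ‖a‖ < 1) (hb : ‖b‖ < 1) :
    0 < coshHalf a b :=
  Real.sqrt_pos.2 (by linarith [one_le_coshDist ha hb])

end CoshDist

/-! ### Hyperboloid model and the midpoint frame. -/

section Lift

variable {E : Type*} [NormedAddCommGroup E] [InnerProductSpace ℝ E]

/-- The point of the hyperboloid that corresponds to a point of the Poincaré ball. -/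
noncomputable def hyperboloidLift (u : E) : ℝ × E :=
  ((1 + ‖u‖ ^ 2) / (1 - ‖u‖ ^ 2), (2 / (1 - ‖u‖ ^ 2)) • u)

lemma lorentz_hyperboloidLift {u v : E} (hu : ‖u‖ < 1) (hv : ‖v‖ < 1) :
    lorentz (hyperboloidLift u) (hyperboloidLift v) = coshDist u v := by
  have h1 := (one_sub_normSq_pos hu).ne'
  have h2 := (one_sub_normSq_pos hv).ne'
  simp only [lorentz, hyperboloidLift, coshDist, inner_smul_left, inner_smul_right,
    RCLike.conj_to_real, norm_sub_sq_real]
  field_simp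
  ring

/-- Ptolemy's inequality for the four points `p, a, b, o` bounds `coshDist p b`. -/
lemma coshDist_le_of_farthest {o a b p : E} (ho : ‖o‖ < 1) (ha : ‖a‖ < 1) (hb : ‖b‖ < 1)
    (hp : ‖p‖ < 1) (hpo : coshDist o p ≤ coshDist o a) (hbo : coshDist o b ≤ coshDist o a)
    (hpa : coshDist a p ≤ coshDist a b) (hoa : 1 < coshDist o a) :
    coshDist p b - 1 ≤ 4 * (coshDist a b - 1) := by
  set s : E → ℝ := fun u => √(1 - ‖u‖ ^ 2) with hs
  have spos : ∀ {u : E}, ‖u‖ < 1 → 0 < s u := fun hu => Real.sqrt_pos.2 (one_sub_normSq_pos hu)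
  have ssq : ∀ {u : E}, ‖u‖ < 1 → s u ^ 2 = 1 - ‖u‖ ^ 2 := fun hu =>
    Real.sq_sqrt (one_sub_normSq_pos hu).le
  -- This is `sinh` of half the hyperbolic distance.
  set σ : E → E → ℝ := fun u v => dist u v / (s u * s v) with hσ
  have σ0 : ∀ {u v : E}, ‖u‖ < 1 → ‖v‖ < 1 → 0 ≤ σ u v := fun hu hv =>
    div_nonneg dist_nonneg (mul_pos (spos hu) (spos hv)).le
  have key : ∀ {u v : E}, ‖u‖ < 1 → ‖v‖ < 1 → coshDist u v = 1 + 2 * σ u v ^ 2 := by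
    intro u v hu hv
    simp only [coshDist, hσ, div_pow, mul_pow, ssq hu, ssq hv, dist_eq_norm]
    ring
  have σcomm : ∀ u v, σ u v = σ v u := fun u v => by
    simp only [hσ, dist_comm, mul_comm]
  -- All three products carry the same denominator `s p * s b * s a * s o`, so Euclidean Ptolemy
  -- transfers to `σ`.
  have pt : σ p b * σ a o ≤ σ p a * σ b o + σ a b * σ p o := by
    have h := EuclideanGeometry.mul_dist_le_mul_dist_add_mul_dist p a b o
    have h1 := spos ho; have h2 := spos ha; have h3 := spos hb; have h4 := spos hp
    simp only [hσ]
    have e1 : dist p b / (s p * s b) * (dist a o / (s a * s o))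
        = (dist p b * dist a o) / (s p * s b * s a * s o) := by field_simp
    have e2 : dist p a / (s p * s a) * (dist b o / (s b * s o))
        + dist a b / (s a * s b) * (dist p o / (s p * s o))
        = (dist p a * dist b o + dist a b * dist p o) / (s p * s b * s a * s o) := by field_simp
    rw [e1, e2]
    gcongr
  rw [key ho hp, key ho ha] at hpo
  rw [key ho hb, key ho ha] at hbo
  rw [key ha hp, key ha hb] at hpa
  rw [key ho ha] at hoa
  rw [key hp hb, key ha hb]
  have hpo' : σ p o ≤ σ a o := by
    rw [σcomm p, σcomm a]; exact (sq_le_sq₀ (σ0 ho hp) (σ0 ho ha)).1 (by linarith)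
  have hbo' : σ b o ≤ σ a o := by
    rw [σcomm b, σcomm a]; exact (sq_le_sq₀ (σ0 ho hb) (σ0 ho ha)).1 (by linarith)
  have hpa' : σ p a ≤ σ a b := by
    rw [σcomm p]; exact (sq_le_sq₀ (σ0 ha hp) (σ0 ha hb)).1 (by linarith)
  have hao : 0 < σ a o := by
    rw [σcomm]; exact lt_of_le_of_ne (σ0 ho ha) (fun h => by rw [← h] at hoa; norm_num at hoa)
  -- Both terms on the right of Ptolemy are at most `σ a b * σ a o`. The triangle inequality would
  -- bound `cosh` only by about its square; here the loss is a constant factor.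
  have h2 : σ p b ≤ 2 * σ a b := by
    have h5 : σ p a * σ b o ≤ σ a b * σ a o := mul_le_mul hpa' hbo' (σ0 hb ho) (σ0 ha hb)
    have h6 : σ a b * σ p o ≤ σ a b * σ a o := mul_le_mul_of_nonneg_left hpo' (σ0 ha hb)
    exact le_of_mul_le_mul_right (by linarith) hao
  have := pow_le_pow_left₀ (σ0 hp hb) h2 2
  linarith

/-- The sum of the hyperbolic cosines of the distances to `a` and `b`. -/
noncomputable def coshSum (a b x : E) : ℝ := coshDist x a + coshDist x b

/-- A multiple of the squared distance between the spatial parts of the lifts of `x` and `y` in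
the frame of the hyperbolic midpoint of `a` and `b`. -/
noncomputable def frameSep (a b x y : E) : ℝ :=
  (coshSum a b x - coshSum a b y) * (coshSum a b x - coshSum a b y) +
    4 * (1 + coshDist a b) * (coshDist x y - 1)

/-- The hyperbolic midpoint of `a` and `b` in the hyperboloid model. -/
noncomputable def midLift (a b : E) : ℝ × E :=
  (2 * coshHalf a b)⁻¹ • (hyperboloidLift a + hyperboloidLift b)

lemma midLift_fst_pos {a b : E} (ha : ‖a‖ < 1) (hb : ‖b‖ < 1) :
    0 < (midLift a b).1 := by
  have h1 := one_sub_normSq_pos ha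
  have h2 := one_sub_normSq_pos hb
  have h3 := coshHalf_pos ha hb
  simp only [midLift, hyperboloidLift, Prod.smul_fst, Prod.fst_add, smul_eq_mul]
  positivity

lemma lorentz_midLift {a b : E} (ha : ‖a‖ < 1) (hb : ‖b‖ < 1)
    {x : E} (hx : ‖x‖ < 1) :
    lorentz (hyperboloidLift x) (midLift a b) = coshSum a b x / (2 * coshHalf a b) := by
  rw [midLift, lorentz_smul_right, lorentz_add_right, lorentz_hyperboloidLift hx ha,
    lorentz_hyperboloidLift hx hb, coshSum]
  field_simp

lemma lorentz_midLift_self {a b : E} (ha : ‖a‖ < 1) (hb : ‖b‖ < 1) :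
    lorentz (midLift a b) (midLift a b) = 1 := by
  have h := coshHalf_sq ha hb
  have h0 := (coshHalf_pos ha hb).ne'
  rw [midLift, lorentz_smul_right, lorentz_smul_left]
  simp only [lorentz_add_right, lorentz_add_left, lorentz_hyperboloidLift ha hb,
    lorentz_hyperboloidLift hb ha, lorentz_hyperboloidLift ha ha, lorentz_hyperboloidLift hb hb,
    coshDist_self, coshDist_comm b a]
  field_simp
  linarith

/-- The factor `2 * (1 + coshDist a b) = (2 * coshHalf a b) ^ 2` clears the square root in the
normalization of `midLift`, leaving a quantity that a program can compute with field operations. -/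
lemma frameSep_eq {a b : E} (ha : ‖a‖ < 1) (hb : ‖b‖ < 1)
    {x y : E} (hx : ‖x‖ < 1) (hy : ‖y‖ < 1) :
    frameSep a b x y = 2 * (1 + coshDist a b) *
      ‖boost (midLift a b) (hyperboloidLift x) - boost (midLift a b) (hyperboloidLift y)‖ ^ 2 := by
  have h := coshHalf_sq ha hb
  have h0 := (coshHalf_pos ha hb).ne'
  rw [← boost_sub, norm_boost_sq (lorentz_midLift_self ha hb) (midLift_fst_pos ha hb)]
  simp only [lorentz_sub_left, lorentz_sub_right, lorentz_midLift ha hb hx,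
    lorentz_midLift ha hb hy,
    lorentz_hyperboloidLift hx hx, lorentz_hyperboloidLift hx hy, lorentz_hyperboloidLift hy hx,
    lorentz_hyperboloidLift hy hy, coshDist_self, coshDist_comm y x]
  have h2 : 2 * (1 + coshDist a b) = (2 * coshHalf a b) ^ 2 := by rw [mul_pow, h]; ring
  have h3 : 4 * (1 + coshDist a b) = 2 * (2 * coshHalf a b) ^ 2 := by rw [← h2]; ring
  rw [h2, frameSep, h3]
  field_simp
  ring

lemma frameSep_le_iff {a b : E} (ha : ‖a‖ < 1) (hb : ‖b‖ < 1)
    {x y : E} (hx : ‖x‖ < 1) (hy : ‖y‖ < 1) {ε : ℝ} (hε : 0 ≤ ε) :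
    frameSep a b x y ≤ (ε * (1 + coshDist a b) / 8) * (ε * (1 + coshDist a b) / 8) ↔
      ‖boost (midLift a b) (hyperboloidLift x) - boost (midLift a b) (hyperboloidLift y)‖ ≤
        ε * coshHalf a b / 8 := by
  have h0 := coshHalf_pos ha hb
  have h1 := one_le_coshDist ha hb
  rw [frameSep_eq ha hb hx hy, ← sq_le_sq₀ (norm_nonneg _) (by positivity), div_pow, mul_pow,
    coshHalf_sq ha hb]
  have h2 : ε * (1 + coshDist a b) / 8 * (ε * (1 + coshDist a b) / 8) =
    2 * (1 + coshDist a b) * (ε ^ 2 * ((1 + coshDist a b) / 2) / 8 ^ 2) := by ring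
  rw [h2]
  exact mul_le_mul_iff_right₀ (by positivity)

/-- On the hyperboloid the spatial part is shorter than the time coordinate `coshSum a b x / (2 *
coshHalf a b)`, whose numerator is at most `5 * (1 + coshDist a b) = 10 * coshHalf a b ^ 2`. -/
lemma norm_boost_le {a b : E} (ha : ‖a‖ < 1) (hb : ‖b‖ < 1)
    {x : E} (hx : ‖x‖ < 1) (h1 : coshDist x a ≤ coshDist a b)
    (h2 : coshDist x b - 1 ≤ 4 * (coshDist a b - 1)) :
    ‖boost (midLift a b) (hyperboloidLift x)‖ ≤ 5 * coshHalf a b := by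
  have h0 := coshHalf_pos ha hb
  have h := coshHalf_sq ha hb
  have hx1 := one_le_coshDist hx ha
  have hx2 := one_le_coshDist hx hb
  rw [← sq_le_sq₀ (norm_nonneg _) (by positivity),
    norm_boost_sq (lorentz_midLift_self ha hb) (midLift_fst_pos ha hb), lorentz_midLift ha hb hx,
    lorentz_hyperboloidLift hx hx, coshDist_self]
  have h3 : coshSum a b x / (2 * coshHalf a b) ≤ 5 * coshHalf a b := by
    rw [div_le_iff₀ (by positivity)]
    have : 5 * coshHalf a b * (2 * coshHalf a b) = 10 * coshHalf a b ^ 2 := by ring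
    rw [this, h, coshSum]; linarith
  have h4 : 0 ≤ coshSum a b x / (2 * coshHalf a b) := by
    unfold coshSum; positivity
  have := pow_le_pow_left₀ h4 h3 2
  linarith

/-- A point whose lift is close to the lift of `p` in the midpoint frame is, up to a factor, as far
as `p` from every `q` for which `p` is at least as far as `a` and `b`. -/
lemma coshDist_ge_of_close {a b : E} (ha : ‖a‖ < 1) (hb : ‖b‖ < 1)
    {q p p' : E} (hq : ‖q‖ < 1) (hp : ‖p‖ < 1) (hp' : ‖p'‖ < 1)
    (hqa : coshDist q a ≤ coshDist q p) (hqb : coshDist q b ≤ coshDist q p) {ε : ℝ}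
    (hclose : ‖boost (midLift a b) (hyperboloidLift p) - boost (midLift a b) (hyperboloidLift p')‖ ≤
        ε * coshHalf a b / 8) :
    (1 - ε / 4) * coshDist q p ≤ coshDist q p' ∧ coshHalf a b ≤ coshDist q p := by
  have hG := coshHalf_pos ha hb
  have hm := lorentz_midLift_self ha hb
  have hm0 := midLift_fst_pos ha hb
  have hq1 := one_le_coshDist hq ha
  have hq2 := one_le_coshDist hq hb
  set m := midLift a b with hmdef
  set Q := hyperboloidLift q with hQ
  set Y := hyperboloidLift p - hyperboloidLift p' with hY
  have hQm : lorentz Q m = coshSum a b q / (2 * coshHalf a b) := lorentz_midLift ha hb hq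
  have hQm0 : 0 ≤ lorentz Q m := by rw [hQm, coshSum]; positivity
  have hbQ2 : ‖boost m Q‖ ^ 2 = lorentz Q m ^ 2 - 1 := by
    rw [norm_boost_sq hm hm0, lorentz_hyperboloidLift hq hq, coshDist_self]
  have hbQ : ‖boost m Q‖ ≤ lorentz Q m := by
    rw [← sq_le_sq₀ (norm_nonneg _) hQm0]; linarith
  have hQm1 : 1 ≤ lorentz Q m := by
    rw [← one_le_sq_iff₀ hQm0]; linarith [sq_nonneg ‖boost m Q‖]
  -- A difference of two points of the hyperboloid is not timelike, so its time coordinate is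
  -- controlled by its spatial part.
  have hYY : lorentz Y Y ≤ 0 := by
    simp only [hY, lorentz_sub_left, lorentz_sub_right, lorentz_hyperboloidLift hp hp,
      lorentz_hyperboloidLift hp hp', lorentz_hyperboloidLift hp' hp,
      lorentz_hyperboloidLift hp' hp', coshDist_self, coshDist_comm p' p]
    linarith [one_le_coshDist hp hp']
  have hYm : |lorentz Y m| ≤ ‖boost m Y‖ := by
    apply abs_le_of_sq_le_sq _ (norm_nonneg _)
    rw [norm_boost_sq hm hm0]; linarith
  have hbY : ‖boost m Y‖ ≤ ε * coshHalf a b / 8 := by rw [hY, boost_sub]; exact hclose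
  have hmain := abs_lorentz_le hm hm0 Q Y
  rw [abs_of_nonneg hQm0] at hmain
  have hQY : lorentz Q Y = coshDist q p - coshDist q p' := by
    rw [hY, lorentz_sub_right, lorentz_hyperboloidLift hq hp, lorentz_hyperboloidLift hq hp']
  have h1 : lorentz Q m * |lorentz Y m| ≤ lorentz Q m * (ε * coshHalf a b / 8) :=
    mul_le_mul_of_nonneg_left (hYm.trans hbY) hQm0
  have h2 : ‖boost m Q‖ * ‖boost m Y‖ ≤ lorentz Q m * (ε * coshHalf a b / 8) :=
    mul_le_mul hbQ hbY (norm_nonneg _) hQm0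
  have h3 := le_abs_self (lorentz Q Y)
  -- The left side is the mean of `coshDist q a` and `coshDist q b`; this turns the absolute error
  -- into a relative one.
  have h4 : lorentz Q m * coshHalf a b ≤ coshDist q p := by
    rw [hQm, coshSum]; field_simp; linarith
  -- The closeness hypothesis forces this sign, since a norm is nonnegative and `coshHalf a b` is
  -- positive.
  have hε : 0 ≤ ε := by
    by_contra hneg
    have := norm_nonneg (boost m Y)
    nlinarith
  refine ⟨?_, ?_⟩
  · nlinarith [mul_le_mul_of_nonneg_left h4 hε]
  · nlinarith

end Lift

/-! ### From relative error in `cosh` to additive error in distance. -/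

lemma cosh_sub_le {d ε : ℝ} (hd0 : 0 ≤ d) (hd : 3 ≤ Real.cosh d) (hε : 0 ≤ ε) (hε1 : ε ≤ 1) :
    Real.cosh (d - ε) ≤ (1 - ε / 4) * Real.cosh d := by
  have hd1 := Real.cosh_sub_sinh d
  have hε2 := Real.cosh_sub_sinh ε
  have hexp : Real.exp (-d) ≤ 1 / 3 := by
    have : Real.cosh d ≤ Real.exp d := by
      rw [← Real.cosh_add_sinh]; linarith [Real.sinh_nonneg_iff.2 hd0]
    rw [Real.exp_neg, inv_le_comm₀ (Real.exp_pos _) (by norm_num)]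
    linarith
  -- The first summand is at most `(1 - ε/2) * cosh d` and the second at most `ε/2`; the latter is
  -- below `(ε/4) * cosh d` because `cosh d ≥ 2`.
  have hsplit : Real.cosh (d - ε) =
      Real.cosh d * Real.exp (-ε) + Real.exp (-d) * Real.sinh ε := by
    rw [Real.cosh_sub, ← hd1, ← hε2]; ring
  have hneg : Real.exp (-ε) ≤ 1 - ε / 2 := by
    rw [Real.exp_neg, inv_le_comm₀ (Real.exp_pos _) (by linarith)]
    refine le_trans ?_ (Real.add_one_le_exp ε)
    rw [inv_le_iff_one_le_mul₀ (by linarith)]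
    nlinarith
  have hsinh : Real.sinh ε ≤ 3 / 2 * ε := by
    have h1 := (abs_le.1 (Real.abs_exp_sub_one_sub_id_le (x := ε) (by rwa [abs_of_nonneg hε]))).2
    have h2 := Real.add_one_le_exp (-ε)
    rw [Real.sinh_eq]
    nlinarith
  have hmul : Real.exp (-d) * Real.sinh ε ≤ 1 / 3 * (3 / 2 * ε) :=
    mul_le_mul hexp hsinh (Real.sinh_nonneg_iff.2 hε) (by norm_num)
  rw [hsplit]
  nlinarith [mul_le_mul_of_nonneg_left hneg (by linarith : 0 ≤ Real.cosh d)]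

lemma arcosh_sub_le {x y ε : ℝ} (hx : 3 ≤ x) (hy : 1 ≤ y) (hε : 0 ≤ ε) (hε1 : ε ≤ 1)
    (hxy : (1 - ε / 4) * x ≤ y) : Real.arcosh x - ε ≤ Real.arcosh y := by
  have hcx := Real.cosh_arcosh (by linarith : 1 ≤ x)
  have h := cosh_sub_le (Real.arcosh_nonneg (by linarith : 1 ≤ x)) (by rwa [hcx]) hε hε1
  rw [hcx] at h
  by_contra! hlt
  have h0 := Real.arcosh_nonneg hy
  have habs : |Real.arcosh y| < |Real.arcosh x - ε| := by
    rwa [abs_of_nonneg h0, abs_of_pos (h0.trans_lt hlt)]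
  have := Real.cosh_lt_cosh.2 habs
  rw [Real.cosh_arcosh hy] at this
  linarith

/-- The value `18` is ample: `cosh d_H(a,b) ≥ 17` already gives `cosh (d_H(a,b)/2) ≥ 3`. -/
lemma eighteen_le_cosh_five : 18 ≤ Real.cosh 5 := by
  have h : (2.7 : ℝ) ^ 5 ≤ Real.exp 1 ^ 5 :=
    pow_le_pow_left₀ (by norm_num) (by linarith [Real.exp_one_gt_d9]) 5
  rw [← Real.exp_nat_mul] at h
  norm_num at h
  rw [Real.cosh_eq]
  linarith [Real.exp_pos (-5)]

lemma eighteen_le_of_five_le_arcosh {x : ℝ} (hx : 1 ≤ x) (h : 5 ≤ Real.arcosh x) : 18 ≤ x := by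
  rw [← Real.cosh_arcosh hx]
  refine eighteen_le_cosh_five.trans (Real.cosh_le_cosh.2 ?_)
  rwa [abs_of_nonneg (Real.arcosh_nonneg hx), abs_of_pos (by norm_num)]

/-! ### Packing bound. -/

/-- A grid bound for the size of a separated family in a Euclidean ball. -/
lemma card_le_of_separated {D k : ℕ} (x : Fin k → EuclideanSpace ℝ (Fin D)) {r δ : ℝ} (hr : 0 ≤ r)
    (hδ : 0 < δ) (hx : ∀ i, ‖x i‖ ≤ r) (hsep : ∀ i j, i ≠ j → δ < ‖x i - x j‖) :
    (k : ℝ) ≤ (2 * r * (D + 1) / δ + 1) ^ D := by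
  -- A cube of side `w` has diameter at most `δ`, as `D ≤ (D + 1) ^ 2`; the summand `1` keeps the
  -- denominator nonzero for `D = 0`.
  set w : ℝ := δ / (D + 1) with hw
  have hw0 : 0 < w := by positivity
  have hrw : 2 * r * (D + 1) / δ = 2 * r / w := by rw [hw]; field_simp
  rw [hrw]
  have hcoord : ∀ i l, |x i l| ≤ r := fun i l => (PiLp.norm_apply_le (x i) l).trans (hx i)
  have hnn : ∀ i l, 0 ≤ (x i l + r) / w := fun i l =>
    div_nonneg (by linarith [(abs_le.1 (hcoord i l)).1]) hw0.le
  let cell : Fin k → Fin D → Fin (⌊2 * r / w⌋₊ + 1) := fun i l =>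
    ⟨⌊(x i l + r) / w⌋₊, Nat.lt_succ_of_le (Nat.floor_le_floor (by
      gcongr; linarith [(abs_le.1 (hcoord i l)).2]))⟩
  have hinj : Function.Injective cell := by
    intro i j hij
    by_contra hne
    have hlt := hsep i j hne
    have hdiff : ∀ l, |x i l - x j l| ≤ w := by
      intro l
      have hc : ⌊(x i l + r) / w⌋₊ = ⌊(x j l + r) / w⌋₊ := congrArg Fin.val (congrFun hij l)
      have h1 := Nat.floor_le (hnn i l)
      have h2 := Nat.lt_floor_add_one ((x i l + r) / w)
      have h3 := Nat.floor_le (hnn j l)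
      have h4 := Nat.lt_floor_add_one ((x j l + r) / w)
      rw [← hc] at h3 h4
      have h5 : |(x i l + r) / w - (x j l + r) / w| ≤ 1 := by rw [abs_le]; constructor <;> linarith
      rw [← sub_div, abs_div, abs_of_pos hw0, div_le_one hw0] at h5
      rwa [add_sub_add_right_eq_sub] at h5
    have hsq : ‖x i - x j‖ ^ 2 ≤ δ ^ 2 := by
      rw [EuclideanSpace.norm_sq_eq]
      calc ∑ l, ‖(x i - x j) l‖ ^ 2 ≤ ∑ _l : Fin D, w ^ 2 :=
            Finset.sum_le_sum fun l _ => pow_le_pow_left₀ (norm_nonneg _) (hdiff l) 2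
        _ = D * w ^ 2 := by simp
        _ ≤ (D + 1) ^ 2 * w ^ 2 := by gcongr; nlinarith [(Nat.cast_nonneg D : (0 : ℝ) ≤ D)]
        _ = δ ^ 2 := by rw [hw]; field_simp
    linarith [(sq_le_sq₀ (norm_nonneg _) hδ.le).1 hsq]
  have hcard := Fintype.card_le_of_injective cell hinj
  simp only [Fintype.card_fin, Fintype.card_fun] at hcard
  calc (k : ℝ) ≤ ((⌊2 * r / w⌋₊ + 1 : ℕ) : ℝ) ^ D := by exact_mod_cast hcard
    _ ≤ (2 * r / w + 1) ^ D := by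
      gcongr
      push_cast
      linarith [Nat.floor_le (by positivity : 0 ≤ 2 * r / w)]

/-! ### Program logic with time bounds. -/

namespace RealRAM

/-- `Runs p s T Q`: started on `s`, the program `p` halts after at most `T` units of time in a
memory that satisfies `Q`. -/
def Runs (p : Prog) (s : Memory) (T : ℕ) (Q : Memory → Prop) : Prop :=
  ∃ t s', Exec p s t s' ∧ t ≤ T ∧ Q s'

namespace Runs

variable {p q : Prog} {b : Test} {s : Memory} {T T' : ℕ} {Q R : Memory → Prop}

lemma mono (h : Runs p s T Q) (hT : T ≤ T') (hQ : ∀ s', Q s' → R s') : Runs p s T' R := by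
  obtain ⟨t, s', h1, h2, h3⟩ := h
  exact ⟨t, s', h1, h2.trans hT, hQ _ h3⟩

lemma skip (h : Q s) : Runs .skip s 1 Q := ⟨_, _, .skip s, le_rfl, h⟩

lemma setNat {a : ℕ} {i x : NatExpr} (h : Q (s.updateNat a (i.eval s) (x.eval s))) :
    Runs (.setNat a i x) s (i.cost + x.cost + 1) Q := ⟨_, _, .setNat s a i x, le_rfl, h⟩

lemma seq (h : Runs p s T Q) (h' : ∀ s', Q s' → Runs q s' T' R) :
    Runs (.seq p q) s (T + T') R := by
  obtain ⟨t, s', h1, h2, h3⟩ := h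
  obtain ⟨t', s'', h4, h5, h6⟩ := h' _ h3
  exact ⟨_, _, .seq h1 h4, add_le_add h2 h5, h6⟩

lemma ite (h : b.Holds s → Runs p s T Q) (h' : ¬ b.Holds s → Runs q s T' Q) :
    Runs (.ite b p q) s (b.cost + 1 + (T + T')) Q := by
  by_cases hb : b.Holds s
  · obtain ⟨t, s', h1, h2, h3⟩ := h hb
    exact ⟨_, _, .iteTrue hb h1, by omega, h3⟩
  · obtain ⟨t, s', h1, h2, h3⟩ := h' hb
    exact ⟨_, _, .iteFalse hb h1, by omega, h3⟩

end Runs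

/-- The value of cell `0` of the natural-number array `a`. -/
def var (a : ℕ) : NatExpr := .read a (.const 0)

/-- Store `x` in cell `0` of the natural-number array `a`. -/
def assign (a : ℕ) (x : NatExpr) : Prog := .setNat a (.const 0) x

/-- Run `body` while the counter `c` is below `bound`, incrementing the counter after each round. -/
def countLoop (c : ℕ) (bound : NatExpr) (body : Prog) : Prog :=
  .while (.natLt (var c) bound) (.seq body (assign c (.add (var c) (.const 1))))

lemma Runs.assign {a : ℕ} {x : NatExpr} {s : Memory} {Q : Memory → Prop}
    (h : Q (s.updateNat a 0 (x.eval s))) : Runs (assign a x) s (x.cost + 2) Q :=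
  (Runs.setNat (i := .const 0) h).mono (by simp only [NatExpr.cost]; omega) fun _ => id

lemma Runs.countLoop {c : ℕ} {bound : NatExpr} {body : Prog} {N T : ℕ} (I : ℕ → Memory → Prop)
    (hI : ∀ m s, I m s → s.nat c 0 = m ∧ bound.eval s = N)
    (hbody : ∀ m s, m < N → I m s →
      Runs body s T fun s' => s'.nat c 0 = m ∧ I (m + 1) (s'.updateNat c 0 (m + 1)))
    {s : Memory} (hs : I 0 s) :
    Runs (countLoop c bound body) s (N * (T + (bound.cost + 10)) + (bound.cost + 10)) (I N) := by
  -- Induction on the number `d` of remaining rounds.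
  suffices h : ∀ d m s, m + d = N → I m s →
      Runs (RealRAM.countLoop c bound body) s (d * (T + (bound.cost + 10)) + (bound.cost + 10))
        (I N) from h N 0 s (by omega) hs
  intro d
  induction d with
  | zero =>
    intro m s hm hs
    obtain ⟨h1, h2⟩ := hI m s hs
    refine ⟨_, s, .whileFalse ?_, ?_, ?_⟩
    · simp only [Test.Holds, var, NatExpr.eval]; omega
    · simp only [Test.cost, var, NatExpr.cost]; omega
    · obtain rfl : m = N := by omega
      exact hs
  | succ d ih =>
    intro m s hm hs
    obtain ⟨h1, h2⟩ := hI m s hs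
    obtain ⟨t, s', e1, ht, hc, hs'⟩ := hbody m s (by omega) hs
    obtain ⟨t', s'', e2, ht', hs''⟩ := ih (m + 1) _ (by omega) hs'
    have e3 : Exec (RealRAM.assign c (.add (var c) (.const 1))) s' 6
        (s'.updateNat c 0 (m + 1)) := by
      have := Exec.setNat s' c (.const 0) (.add (var c) (.const 1))
      simp only [NatExpr.eval, var, hc] at this
      exact this
    refine ⟨_, s'', .whileTrue ?_ (.seq e1 e3) e2, ?_, hs''⟩
    · simp only [Test.Holds, var, NatExpr.eval]; omega
    · simp only [Test.cost, var, NatExpr.cost]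
      rw [Nat.succ_mul]
      omega

lemma updateNat_nat (s : Memory) (a i v b j : ℕ) :
    (s.updateNat a i v).nat b j = if b = a ∧ j = i then v else s.nat b j := by
  simp only [Memory.updateNat, Function.update_apply]
  by_cases h : b = a
  · subst h; simp [Function.update_apply]
  · simp [h]

lemma updateNat_nat_of_ne (s : Memory) {a b : ℕ} (i v : ℕ) (h : b ≠ a) :
    (s.updateNat a i v).nat b = s.nat b := by
  simp [Memory.updateNat, h]

lemma updateNat_nat_self (s : Memory) (a i v : ℕ) : (s.updateNat a i v).nat a i = v := by
  simp [updateNat_nat]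

/-! ### The coreset program. -/

/-- The sum of the first `k` terms of a sequence of expressions. -/
def sumExpr (f : ℕ → RealExpr) : ℕ → RealExpr
  | 0 => .const 0
  | k + 1 => .add (sumExpr f k) (f k)

lemma sumExpr_eval (f : ℕ → RealExpr) (s : Memory) (k : ℕ) :
    (sumExpr f k).eval s = ∑ j ∈ Finset.range k, (f j).eval s := by
  induction k with
  | zero => simp [sumExpr, RealExpr.eval]
  | succ k ih => rw [sumExpr, RealExpr.eval, ih, Finset.sum_range_succ]

/-- The square of an expression. -/
def sqExpr (x : RealExpr) : RealExpr := .mul x x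

/-- The squared norm of the point with index `e`. -/
def normSqExpr (D : ℕ) (e : NatExpr) : RealExpr := sumExpr (fun j => sqExpr (.read (j + 1) e)) D

/-- The squared Euclidean distance of the points with indices `e` and `e₂`. -/
def distSqExpr (D : ℕ) (e e₂ : NatExpr) : RealExpr :=
  sumExpr (fun j => sqExpr (.sub (.read (j + 1) e) (.read (j + 1) e₂))) D

/-- The hyperbolic cosine of the distance of the points with indices `e` and `e₂`. -/
def coshDistExpr (D : ℕ) (e e₂ : NatExpr) : RealExpr :=
  .add (.const 1) (.div (.mul (.const 2) (distSqExpr D e e₂))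
    (.mul (.sub (.const 1) (normSqExpr D e)) (.sub (.const 1) (normSqExpr D e₂))))

def coshSumExpr (D : ℕ) (a b e : NatExpr) : RealExpr :=
  .add (coshDistExpr D e a) (coshDistExpr D e b)

def frameSepExpr (D : ℕ) (a b e e₂ : NatExpr) : RealExpr :=
  .add (sqExpr (.sub (coshSumExpr D a b e) (coshSumExpr D a b e₂)))
    (.mul (.mul (.const 4) (.add (.const 1) (coshDistExpr D a b)))
      (.sub (coshDistExpr D e e₂) (.const 1)))

def thresholdExpr (D : ℕ) (a b : NatExpr) : RealExpr :=
  .div (.mul (.read 0 (.const 0)) (.add (.const 1) (coshDistExpr D a b))) (.const 8)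

/-- The points with indices `e` and `e₂` are far apart in the midpoint frame. -/
def farTest (D : ℕ) (a b e e₂ : NatExpr) : Test :=
  .realLt (sqExpr (thresholdExpr D a b)) (frameSepExpr D a b e e₂)

/-- Store in variable `dst` the index of a point farthest from the one with index `src`; the loop
counter is variable `3`. -/
def farthestProg (D dst : ℕ) (src : NatExpr) : Prog :=
  .seq (assign dst (.const 0)) (.seq (assign 3 (.const 0))
    (countLoop 3 (var 0)
      (.ite (.realLt (coshDistExpr D src (var dst)) (coshDistExpr D src (var 3)))
        (assign dst (var 3)) .skip)))

/-- Set variable `7` to `1` if the point with index in variable `3` is close to a selected one. -/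
def scanProg (D : ℕ) : Prog :=
  .seq (assign 7 (.const 0)) (.seq (assign 4 (.const 0))
    (countLoop 4 (var 1)
      (.ite (farTest D (var 5) (var 6) (var 3) (.read 2 (var 4))) .skip (assign 7 (.const 1)))))

/-- Select the point with index in variable `3` unless variable `7` is positive. -/
def selectProg : Prog :=
  .ite (.natLt (var 7) (.const 1))
    (.seq (.setNat 2 (var 1) (var 3)) (assign 1 (.add (var 1) (.const 1)))) .skip

/-- Greedy selection of points that are pairwise far apart in the frame of the midpoint of a pair
of nearly maximal distance. -/
def coresetProg (D : ℕ) : Prog :=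
  .seq (farthestProg D 5 (.const 0)) (.seq (farthestProg D 6 (var 5))
    (.seq (assign 3 (.const 0)) (countLoop 3 (var 0) (.seq (scanProg D) selectProg))))

end RealRAM

open RealRAM

/-! ### Correctness and running time of the program. -/

section Correctness

variable {D n : ℕ}

/-- The point with index `i`, the origin when there is none. -/
noncomputable def pointAt (P : Fin n → PBall D) (i : ℕ) : EuclideanSpace ℝ (Fin D) :=
  if h : i < n then (P ⟨i, h⟩).1 else 0

lemma norm_pointAt_lt (P : Fin n → PBall D) (i : ℕ) : ‖pointAt P i‖ < 1 := by
  unfold pointAt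
  split_ifs with h
  · exact mem_ball_zero_iff.1 (P ⟨i, h⟩).2
  · simp

lemma coresetInput_real_succ (P : Fin n → PBall D) (ε : ℝ) (j : Fin D) (i : ℕ) :
    (coresetInput P ε).real (j + 1) i = pointAt P i j := by
  simp only [coresetInput, pointAt]
  by_cases h : i < n <;> simp [h]

variable {P : Fin n → PBall D} {ε : ℝ} {s : Memory}

lemma coshDistExpr_eval (hs : s.real = (coresetInput P ε).real) (e e₂ : NatExpr) :
    (coshDistExpr D e e₂).eval s = coshDist (pointAt P (e.eval s)) (pointAt P (e₂.eval s)) := by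
  simp only [coshDistExpr, RealExpr.eval, normSqExpr, distSqExpr, sumExpr_eval, sqExpr, hs,
    Finset.sum_range, coresetInput_real_succ, coshDist, EuclideanSpace.real_norm_sq_eq,
    PiLp.sub_apply, ← pow_two, Rat.cast_one, Rat.cast_ofNat]

lemma farTest_holds (hs : s.real = (coresetInput P ε).real) (a b e e₂ : NatExpr) :
    (farTest D a b e e₂).Holds s ↔
      (ε * (1 + coshDist (pointAt P (a.eval s)) (pointAt P (b.eval s))) / 8) *
        (ε * (1 + coshDist (pointAt P (a.eval s)) (pointAt P (b.eval s))) / 8) <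
      frameSep (pointAt P (a.eval s)) (pointAt P (b.eval s)) (pointAt P (e.eval s))
        (pointAt P (e₂.eval s)) := by
  have h0 : s.real 0 0 = ε := by rw [hs]; simp [coresetInput]
  simp only [farTest, Test.Holds, thresholdExpr, frameSepExpr, coshSumExpr, sqExpr, RealExpr.eval,
    NatExpr.eval, coshDistExpr_eval hs, frameSep, coshSum, h0, Rat.cast_one, Rat.cast_ofNat]

/-- The bound `3 < dst` keeps the result apart from the counter and from the stored `n`; `hsrc` says
that the loop's own writes do not move the source point. -/
lemma farthestProg_runs {dst : ℕ} {src : NatExpr} {x : ℕ} (hdst : 3 < dst) (hn : 0 < n)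
    (hs : s.real = (coresetInput P ε).real) (hs0 : s.nat 0 0 = n)
    (hsrc : ∀ s' : Memory, (∀ c, c ≠ 3 → c ≠ dst → s'.nat c = s.nat c) → src.eval s' = x) :
    Runs (farthestProg D dst src) s
      (n * ((coshDistExpr D src (var dst)).cost + (coshDistExpr D src (var 3)).cost + 30) + 30)
      fun s' => s'.real = s.real ∧ (∀ c, c ≠ 3 → c ≠ dst → s'.nat c = s.nat c) ∧
        s'.nat dst 0 < n ∧
        ∀ i < n, coshDist (pointAt P x) (pointAt P i) ≤
          coshDist (pointAt P x) (pointAt P (s'.nat dst 0)) := by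
  let I : ℕ → Memory → Prop := fun m s' => s'.real = s.real ∧
    (∀ c, c ≠ 3 → c ≠ dst → s'.nat c = s.nat c) ∧ s'.nat 3 0 = m ∧ s'.nat dst 0 < n ∧
    ∀ i < m, coshDist (pointAt P x) (pointAt P i) ≤
      coshDist (pointAt P x) (pointAt P (s'.nat dst 0))
  have hloop := fun s' (h : I 0 s') => Runs.countLoop (c := 3) (bound := var 0) (N := n)
    (body := .ite (.realLt (coshDistExpr D src (var dst)) (coshDistExpr D src (var 3)))
        (assign dst (var 3)) .skip)
    (T := (coshDistExpr D src (var dst)).cost + (coshDistExpr D src (var 3)).cost + 10) I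
    (fun m s' h => ⟨h.2.2.1, by
      rw [var, NatExpr.eval, NatExpr.eval, h.2.1 0 (by omega) (by omega), hs0]⟩)
    (fun m s' hm h => by
      obtain ⟨h1, h2, h3, h4, h5⟩ := h
      have hx := hsrc s' h2
      have hne : dst ≠ 3 := by omega
      refine (Runs.ite (T := 4) (T' := 1) (fun hb => ?_) (fun hb => ?_)).mono
        (by simp only [Test.cost]; omega) fun _ => id
      · simp only [Test.Holds, coshDistExpr_eval (h1.trans hs), hx, var, NatExpr.eval, h3] at hb
        refine (Runs.assign ?_)
        simp only [var, NatExpr.eval, h3]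
        refine ⟨by rw [updateNat_nat_of_ne _ _ _ hne.symm, h3], h1, fun c hc hc' => ?_,
          updateNat_nat_self .., ?_, fun i hi => ?_⟩
        · rw [updateNat_nat_of_ne _ _ _ hc, updateNat_nat_of_ne _ _ _ hc', h2 c hc hc']
        · rw [updateNat_nat_of_ne _ _ _ hne, updateNat_nat_self]; exact hm
        · rw [updateNat_nat_of_ne _ _ _ hne, updateNat_nat_self]
          rcases Nat.lt_succ_iff_lt_or_eq.1 hi with hi | rfl
          · exact (h5 i hi).trans hb.le
          · exact le_rfl
      · simp only [Test.Holds, coshDistExpr_eval (h1.trans hs), hx, var, NatExpr.eval, h3,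
          not_lt] at hb
        refine Runs.skip ⟨h3, h1, fun c hc hc' => ?_, updateNat_nat_self .., ?_, fun i hi => ?_⟩
        · rw [updateNat_nat_of_ne _ _ _ hc, h2 c hc hc']
        · rwa [updateNat_nat_of_ne _ _ _ hne]
        · rw [updateNat_nat_of_ne _ _ _ hne]
          rcases Nat.lt_succ_iff_lt_or_eq.1 hi with hi | rfl
          · exact h5 i hi
          · exact hb) h
  have hne : dst ≠ 3 := by omega
  refine (Runs.seq (Q := fun s' => s' = s.updateNat dst 0 0) (Runs.assign rfl) fun s' hs' =>
    Runs.seq (Q := fun s'' => s'' = s'.updateNat 3 0 0) (Runs.assign rfl) fun s'' hs'' =>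
      hloop s'' ?_).mono ?_ ?_
  · subst hs' hs''
    refine ⟨rfl, fun c hc hc' => ?_, updateNat_nat_self .., ?_, fun i hi => absurd hi (by omega)⟩
    · rw [updateNat_nat_of_ne _ _ _ hc, updateNat_nat_of_ne _ _ _ hc']
    -- The initial candidate `0` is a valid index only because `n` is positive.
    · rw [updateNat_nat_of_ne _ _ _ hne, updateNat_nat_self]; exact hn
  · simp only [var, NatExpr.cost]
    have : ∀ A : ℕ, n * (A + 10 + (1 + 1 + 10)) ≤ n * (A + 30) := fun A =>
      Nat.mul_le_mul_left _ (by omega)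
    have := this ((coshDistExpr D src (var dst)).cost + (coshDistExpr D src (var 3)).cost)
    simp only [var] at this
    omega
  · rintro s' ⟨h1, h2, -, h4, h5⟩
    exact ⟨h1, h2, h4, h5⟩

/-- The points with indices `i` and `j` are far apart in the frame of the midpoint of the points
with indices `a` and `b`. -/
def Far (P : Fin n → PBall D) (ε : ℝ) (a b i j : ℕ) : Prop :=
  (ε * (1 + coshDist (pointAt P a) (pointAt P b)) / 8) *
      (ε * (1 + coshDist (pointAt P a) (pointAt P b)) / 8) <
    frameSep (pointAt P a) (pointAt P b) (pointAt P i) (pointAt P j)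

/-- The cost of a comparison of two points in the scan for a close selected point. -/
def farCost (D : ℕ) : ℕ := (farTest D (var 5) (var 6) (var 3) (.read 2 (var 4))).cost

lemma scanProg_runs {a b m : ℕ} (hs : s.real = (coresetInput P ε).real) (ha : s.nat 5 0 = a)
    (hb : s.nat 6 0 = b) (hm : s.nat 3 0 = m) :
    Runs (scanProg D) s (s.nat 1 0 * (farCost D + 30) + 30) fun s' => s'.real = s.real ∧
      (∀ c, c ≠ 4 → c ≠ 7 → s'.nat c = s.nat c) ∧
      (s'.nat 7 0 < 1 → ∀ j < s.nat 1 0, Far P ε a b m (s.nat 2 j)) ∧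
      (¬ s'.nat 7 0 < 1 → ∃ j < s.nat 1 0, ¬ Far P ε a b m (s.nat 2 j)) := by
  let I : ℕ → Memory → Prop := fun l s' => s'.real = s.real ∧
    (∀ c, c ≠ 4 → c ≠ 7 → s'.nat c = s.nat c) ∧ s'.nat 4 0 = l ∧
    (s'.nat 7 0 < 1 → ∀ j < l, Far P ε a b m (s.nat 2 j)) ∧
    (¬ s'.nat 7 0 < 1 → ∃ j < s.nat 1 0, ¬ Far P ε a b m (s.nat 2 j))
  have hloop := fun s' (h : I 0 s') => Runs.countLoop (c := 4) (bound := var 1) (N := s.nat 1 0)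
    (body := .ite (farTest D (var 5) (var 6) (var 3) (.read 2 (var 4))) .skip
      (assign 7 (.const 1))) (T := farCost D + 10) I
    (fun l s' h => ⟨h.2.2.1, by
      rw [var, NatExpr.eval, NatExpr.eval, h.2.1 1 (by omega) (by omega)]⟩)
    (fun l s' hl h => by
      obtain ⟨h1, h2, h3, h4, h5⟩ := h
      have htest := farTest_holds (h1.trans hs) (var 5) (var 6) (var 3) (.read 2 (var 4))
      simp only [var, NatExpr.eval, h2 5 (by omega) (by omega), h2 6 (by omega) (by omega),
        h2 3 (by omega) (by omega), h2 2 (by omega) (by omega), h3, ha, hb, hm] at htest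
      refine (Runs.ite (T := 1) (T' := 3) (fun hb => ?_) (fun hb => ?_)).mono
        (by simp only [farCost]; omega) fun _ => id
      · have hfar : Far P ε a b m (s.nat 2 l) := htest.1 hb
        refine Runs.skip ⟨h3, h1, fun c hc hc' => ?_, updateNat_nat_self .., ?_, ?_⟩
        · rw [updateNat_nat_of_ne _ _ _ hc, h2 c hc hc']
        · rw [updateNat_nat_of_ne _ _ _ (by omega)]
          intro h0 j hj
          rcases Nat.lt_succ_iff_lt_or_eq.1 hj with hj | rfl
          · exact h4 h0 j hj
          · exact hfar
        · rwa [updateNat_nat_of_ne _ _ _ (by omega)]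
      · have hfar : ¬ Far P ε a b m (s.nat 2 l) := fun h => hb (htest.2 h)
        refine Runs.assign ⟨?_, h1, fun c hc hc' => ?_, updateNat_nat_self .., ?_, ?_⟩
        · rw [updateNat_nat_of_ne _ _ _ (by omega), h3]
        · rw [updateNat_nat_of_ne _ _ _ hc, updateNat_nat_of_ne _ _ _ hc', h2 c hc hc']
        · rw [updateNat_nat_of_ne _ _ _ (by omega), updateNat_nat_self]
          simp [NatExpr.eval]
        · exact fun _ => ⟨l, hl, hfar⟩) h
  refine (Runs.seq (Q := fun s' => s' = s.updateNat 7 0 0) (Runs.assign rfl) fun s' hs' =>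
    Runs.seq (Q := fun s'' => s'' = s'.updateNat 4 0 0) (Runs.assign rfl) fun s'' hs'' =>
      hloop s'' ?_).mono ?_ ?_
  · subst hs' hs''
    refine ⟨rfl, fun c hc hc' => ?_, updateNat_nat_self .., fun _ j hj => absurd hj (by omega), ?_⟩
    · rw [updateNat_nat_of_ne _ _ _ hc, updateNat_nat_of_ne _ _ _ hc']
    · rw [updateNat_nat_of_ne _ _ _ (by omega), updateNat_nat_self]
      simp
  · simp only [var, NatExpr.cost]
    have : s.nat 1 0 * (farCost D + 10 + (1 + 1 + 10)) ≤ s.nat 1 0 * (farCost D + 30) :=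
      Nat.mul_le_mul_left _ (by omega)
    omega
  · rintro s' ⟨h1, h2, -, h4, h5⟩
    exact ⟨h1, h2, h4, h5⟩

/-- The indices in array `2` form a maximal family of pairwise far points among the first `m`. -/
structure IsGreedyNet (P : Fin n → PBall D) (ε : ℝ) (a b m : ℕ) (s : Memory) : Prop where
  lt : ∀ j < s.nat 1 0, s.nat 2 j < m
  far : ∀ j < s.nat 1 0, ∀ l < j, Far P ε a b (s.nat 2 j) (s.nat 2 l)
  cover : ∀ i < m, ∃ j < s.nat 1 0, ¬ Far P ε a b i (s.nat 2 j)

lemma IsGreedyNet.congr {a b m : ℕ} {s s' : Memory} (h : IsGreedyNet P ε a b m s)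
    (h1 : s'.nat 1 = s.nat 1) (h2 : s'.nat 2 = s.nat 2) : IsGreedyNet P ε a b m s' := by
  constructor
  · rw [h1, h2]; exact h.lt
  · rw [h1, h2]; exact h.far
  · rw [h1, h2]; exact h.cover

/-- This lets a newly selected point cover itself. -/
lemma not_far_self (P : Fin n → PBall D) (ε : ℝ) (a b i : ℕ) : ¬ Far P ε a b i i := by
  simp only [Far, frameSep, coshDist_self, sub_self, mul_zero, add_zero, not_lt]
  exact mul_self_nonneg _

lemma selectProg_runs {a b m : ℕ} (hm : s.nat 3 0 = m) (hnet : IsGreedyNet P ε a b m s)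
    (hfar : s.nat 7 0 < 1 → ∀ j < s.nat 1 0, Far P ε a b m (s.nat 2 j))
    (hclose : ¬ s.nat 7 0 < 1 → ∃ j < s.nat 1 0, ¬ Far P ε a b m (s.nat 2 j)) :
    Runs selectProg s 30 fun s' => s'.real = s.real ∧
      (∀ c, c ≠ 1 → c ≠ 2 → s'.nat c = s.nat c) ∧ IsGreedyNet P ε a b (m + 1) s' := by
  refine (Runs.ite (T := 20) (T' := 1) (fun hb => ?_) (fun hb => ?_)).mono
    (by simp [Test.cost, var, NatExpr.cost]) fun _ => id
  · simp only [Test.Holds, var, NatExpr.eval] at hb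
    set k := s.nat 1 0 with hk
    let s₁ := s.updateNat 2 k m
    let s₂ := s₁.updateNat 1 0 (k + 1)
    refine (Runs.seq (Q := fun s' => s' = s₁) (Runs.setNat ?_) (fun s' hs' =>
      Runs.assign (Q := fun s' => s' = s₂) ?_)).mono
      (by simp [var, NatExpr.cost]) ?_
    · simp only [var, NatExpr.eval, hm, ← hk, s₁]
    · subst hs'
      simp [var, NatExpr.eval, s₂, s₁, updateNat_nat, ← hk]
    · rintro _ rfl
      have hs1 : s₂.nat 1 0 = k + 1 := updateNat_nat_self ..
      have hs2 : s₂.nat 2 k = m := by simp [s₂, s₁, updateNat_nat]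
      have hs3 : ∀ j < k, s₂.nat 2 j = s.nat 2 j := fun j hj => by
        simp [s₂, s₁, updateNat_nat, hj.ne]
      refine ⟨rfl, fun c hc hc' => ?_, ⟨?_, ?_, ?_⟩⟩
      · rw [updateNat_nat_of_ne _ _ _ hc, updateNat_nat_of_ne _ _ _ hc']
      · rw [hs1]
        intro j hj
        rcases Nat.lt_succ_iff_lt_or_eq.1 hj with hj | rfl
        · rw [hs3 j hj]; exact (hnet.lt j hj).trans (Nat.lt_succ_self m)
        · omega
      · rw [hs1]
        intro j hj l hl
        rw [hs3 l (by omega)]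
        rcases Nat.lt_succ_iff_lt_or_eq.1 hj with hj | rfl
        · rw [hs3 j hj]; exact hnet.far j hj l hl
        · rw [hs2]; exact hfar hb l hl
      · rw [hs1]
        intro i hi
        rcases Nat.lt_succ_iff_lt_or_eq.1 hi with hi | rfl
        · obtain ⟨j, hj, h⟩ := hnet.cover i hi
          exact ⟨j, by omega, by rwa [hs3 j hj]⟩
        · exact ⟨k, by omega, by rw [hs2]; exact not_far_self P ε a b i⟩
  · simp only [Test.Holds, var, NatExpr.eval] at hb
    refine Runs.skip ⟨rfl, fun _ _ _ => rfl, ⟨fun j hj => (hnet.lt j hj).trans (Nat.lt_succ_self m),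
      hnet.far, fun i hi => ?_⟩⟩
    rcases Nat.lt_succ_iff_lt_or_eq.1 hi with hi | rfl
    · exact hnet.cover i hi
    · exact hclose hb

/-- A bound for the running time of the program, up to the factor that depends on the input. -/
def stepBound (D : ℕ) : ℕ :=
  (coshDistExpr D (.const 0) (var 5)).cost + (coshDistExpr D (.const 0) (var 3)).cost +
    (coshDistExpr D (var 5) (var 6)).cost + (coshDistExpr D (var 5) (var 3)).cost +
    farCost D + 400

/-- The size bound `hK` is required at every stage `m ≤ n`, since each scan costs time proportional
to the current list. -/
lemma coresetProg_runs (hn : 0 < n) (K : ℕ)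
    (hK : ∀ (a b m : ℕ) (s : Memory), a < n → b < n → m ≤ n →
      (∀ i < n, coshDist (pointAt P 0) (pointAt P i) ≤ coshDist (pointAt P 0) (pointAt P a)) →
      (∀ i < n, coshDist (pointAt P a) (pointAt P i) ≤ coshDist (pointAt P a) (pointAt P b)) →
      IsGreedyNet P ε a b m s → s.nat 1 0 ≤ K) :
    Runs (coresetProg D) (coresetInput P ε) (stepBound D * (n * (K + 1))) fun s =>
      ∃ a b, a < n ∧ b < n ∧
      (∀ i < n, coshDist (pointAt P 0) (pointAt P i) ≤ coshDist (pointAt P 0) (pointAt P a)) ∧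
      (∀ i < n, coshDist (pointAt P a) (pointAt P i) ≤ coshDist (pointAt P a) (pointAt P b)) ∧
      s.nat 1 0 ≤ K ∧ IsGreedyNet P ε a b n s := by
  set s₀ := coresetInput P ε with hs₀
  have h00 : s₀.nat 0 0 = n := by simp [hs₀, coresetInput]
  have h01 : s₀.nat 1 0 = 0 := by simp [hs₀, coresetInput]
  refine ((farthestProg_runs (P := P) (dst := 5) (src := .const 0) (x := 0) (by norm_num) hn rfl h00
    (fun _ _ => rfl)).seq fun s₁ h₁ => ((farthestProg_runs (P := P) (dst := 6) (src := var 5)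
    (x := s₁.nat 5 0) (by norm_num) hn h₁.1 (by rw [h₁.2.1 0 (by omega) (by omega), h00])
    (fun s' h => by rw [var, NatExpr.eval, NatExpr.eval, h 5 (by omega) (by omega)])).seq
    fun s₂ h₂ => (Runs.seq (Q := fun s' => s' = s₂.updateNat 3 0 0) (Runs.assign rfl)
      (T' := n * ((K * (farCost D + 30) + 60) + ((var 0).cost + 10)) + ((var 0).cost + 10))
      (R := fun s => ∃ a b, a < n ∧ b < n ∧
      (∀ i < n, coshDist (pointAt P 0) (pointAt P i) ≤ coshDist (pointAt P 0) (pointAt P a)) ∧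
      (∀ i < n, coshDist (pointAt P a) (pointAt P i) ≤ coshDist (pointAt P a) (pointAt P b)) ∧
      s.nat 1 0 ≤ K ∧ IsGreedyNet P ε a b n s)
      fun s₃ h₃ => ?_))).mono ?_ fun _ => id
  · obtain ⟨hr₁, hf₁, ha, hfa⟩ := h₁
    obtain ⟨hr₂, hf₂, hb, hfb⟩ := h₂
    set a := s₁.nat 5 0 with hadef
    set b := s₂.nat 6 0 with hbdef
    let I : ℕ → Memory → Prop := fun m s => s.real = s₀.real ∧ s.nat 0 0 = n ∧ s.nat 5 0 = a ∧
      s.nat 6 0 = b ∧ s.nat 3 0 = m ∧ IsGreedyNet P ε a b m s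
    have hI0 : I 0 s₃ := by
      subst h₃
      have hk : (s₂.updateNat 3 0 0).nat 1 0 = 0 := by
        rw [updateNat_nat_of_ne _ _ _ (by omega), hf₂ 1 (by omega) (by omega),
          hf₁ 1 (by omega) (by omega), h01]
      refine ⟨hr₂.trans hr₁, ?_, ?_, ?_, updateNat_nat_self .., ⟨?_, ?_, ?_⟩⟩
      · rw [updateNat_nat_of_ne _ _ _ (by omega), hf₂ 0 (by omega) (by omega),
          hf₁ 0 (by omega) (by omega), h00]
      · rw [updateNat_nat_of_ne _ _ _ (by omega), hf₂ 5 (by omega) (by omega)]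
      · rw [updateNat_nat_of_ne _ _ _ (by omega)]
      · rw [hk]; intro j hj; omega
      · rw [hk]; intro j hj; omega
      · intro i hi; omega
    refine (Runs.countLoop (bound := var 0) (N := n) I (fun m s h => ⟨h.2.2.2.2.1, h.2.1⟩)
      (fun m s hm h => ?_) hI0).mono le_rfl ?_
    · obtain ⟨g1, g2, g3, g4, g5, g6⟩ := h
      have hk := hK a b m s ha hb hm.le hfa hfb g6
      refine ((scanProg_runs g1 g3 g4 g5).seq fun s' h' =>
        (selectProg_runs (P := P) (ε := ε) (a := a) (b := b) (m := m)
          (by rw [h'.2.1 3 (by omega) (by omega), g5])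
          (g6.congr (h'.2.1 1 (by omega) (by omega)) (h'.2.1 2 (by omega) (by omega)))
          (by rw [h'.2.1 1 (by omega) (by omega), h'.2.1 2 (by omega) (by omega)]; exact h'.2.2.1)
          (by rw [h'.2.1 1 (by omega) (by omega), h'.2.1 2 (by omega) (by omega)]
              exact h'.2.2.2)).mono le_rfl
        (R := fun s'' => s''.nat 3 0 = m ∧ I (m + 1) (s''.updateNat 3 0 (m + 1)))
        fun s'' h'' => ?_).mono ?_ fun _ => id
      · obtain ⟨e1, e2, -⟩ := h'
        obtain ⟨f1, f2, f3⟩ := h''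
        have hfr : ∀ c, c ≠ 1 → c ≠ 2 → c ≠ 4 → c ≠ 7 → s''.nat c = s.nat c :=
          fun c c1 c2 c4 c7 => (f2 c c1 c2).trans (e2 c c4 c7)
        refine ⟨by rw [hfr 3 (by omega) (by omega) (by omega) (by omega), g5],
          f1.trans (e1.trans g1), ?_, ?_, ?_, updateNat_nat_self .., f3.congr ?_ ?_⟩
        · rw [updateNat_nat_of_ne _ _ _ (by omega),
            hfr 0 (by omega) (by omega) (by omega) (by omega), g2]
        · rw [updateNat_nat_of_ne _ _ _ (by omega),
            hfr 5 (by omega) (by omega) (by omega) (by omega), g3]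
        · rw [updateNat_nat_of_ne _ _ _ (by omega),
            hfr 6 (by omega) (by omega) (by omega) (by omega), g4]
        · rw [updateNat_nat_of_ne _ _ _ (by omega)]
        · rw [updateNat_nat_of_ne _ _ _ (by omega)]
      · have := Nat.mul_le_mul_right (farCost D + 30) hk
        omega
    · rintro s' ⟨-, -, -, -, -, g6⟩
      exact ⟨a, b, ha, hb, hfa, hfb, hK a b n s' ha hb le_rfl hfa hfb g6, g6⟩
  · simp only [stepBound, var, NatExpr.cost]
    generalize (coshDistExpr D (.const 0) (.read 5 (.const 0))).cost = c₁
    generalize (coshDistExpr D (.const 0) (.read 3 (.const 0))).cost = c₂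
    generalize (coshDistExpr D (.read 5 (.const 0)) (.read 6 (.const 0))).cost = c₃
    generalize (coshDistExpr D (.read 5 (.const 0)) (.read 3 (.const 0))).cost = c₄
    generalize farCost D = c₅
    -- With `n` written as a successor, the constant terms are absorbed by `n * (K + 1)` and only
    -- nonnegative monomials are left over.
    obtain ⟨n, rfl⟩ : ∃ l, n = l + 1 := ⟨n - 1, by omega⟩
    ring_nf
    linarith [Nat.zero_le (n * c₁ * K), Nat.zero_le (n * c₂ * K), Nat.zero_le (n * c₃ * K),
      Nat.zero_le (n * c₄ * K), Nat.zero_le (n * K),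
      Nat.zero_le (n * c₅), Nat.zero_le (c₁ * K), Nat.zero_le (c₂ * K),
      Nat.zero_le (c₃ * K), Nat.zero_le (c₄ * K)]

end Correctness

/-! ### Size and quality of the coreset. -/

section Coreset

variable {D n : ℕ} {P : Fin n → PBall D} {ε : ℝ}

lemma not_far_iff (hε : 0 ≤ ε) (a b i j : ℕ) :
    ¬ Far P ε a b i j ↔
      ‖boost (midLift (pointAt P a) (pointAt P b)) (hyperboloidLift (pointAt P i)) -
        boost (midLift (pointAt P a) (pointAt P b)) (hyperboloidLift (pointAt P j))‖ ≤
        ε * coshHalf (pointAt P a) (pointAt P b) / 8 := by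
  rw [Far, not_lt]
  exact frameSep_le_iff (norm_pointAt_lt P a) (norm_pointAt_lt P b) (norm_pointAt_lt P i)
    (norm_pointAt_lt P j) hε

lemma IsGreedyNet.card_le {a b m : ℕ} {s : Memory} (hε : 0 < ε) (hε1 : ε ≤ 1) (hb : b < n)
    (hm : m ≤ n)
    (hfa : ∀ i < n, coshDist (pointAt P 0) (pointAt P i) ≤ coshDist (pointAt P 0) (pointAt P a))
    (hfb : ∀ i < n, coshDist (pointAt P a) (pointAt P i) ≤ coshDist (pointAt P a) (pointAt P b))
    (h1 : 1 < coshDist (pointAt P 0) (pointAt P a)) (h : IsGreedyNet P ε a b m s) :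
    (s.nat 1 0 : ℝ) ≤ (80 * (D + 1) + 1) ^ D * (1 / ε ^ D) := by
  set G := coshHalf (pointAt P a) (pointAt P b) with hG
  have hG0 : 0 < G := coshHalf_pos (norm_pointAt_lt P a) (norm_pointAt_lt P b)
  let x : Fin (s.nat 1 0) → EuclideanSpace ℝ (Fin D) := fun j =>
    boost (midLift (pointAt P a) (pointAt P b)) (hyperboloidLift (pointAt P (s.nat 2 j)))
  have hlt : ∀ j l : Fin (s.nat 1 0), l < j → ε * G / 8 < ‖x j - x l‖ := fun j l hl => by
    by_contra! hle
    exact (not_far_iff hε.le a b _ _).2 hle (h.far j j.2 l hl)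
  have hcard := card_le_of_separated x (r := 5 * G) (δ := ε * G / 8) (by positivity) (by positivity)
    (fun j => by
      have hj : s.nat 2 j < n := (h.lt j j.2).trans_le hm
      refine norm_boost_le (norm_pointAt_lt P a) (norm_pointAt_lt P b) (norm_pointAt_lt P _) ?_ ?_
      · rw [coshDist_comm]; exact hfb _ hj
      · exact coshDist_le_of_farthest (norm_pointAt_lt P 0) (norm_pointAt_lt P a)
          (norm_pointAt_lt P b) (norm_pointAt_lt P _) (hfa _ hj) (hfa b hb) (hfb _ hj) h1)
    (fun j l hne => by
      rcases lt_or_gt_of_ne hne with hjl | hjl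
      · rw [norm_sub_rev]; exact hlt l j hjl
      · exact hlt j l hjl)
  refine hcard.trans ?_
  rw [mul_one_div, ← div_pow]
  gcongr
  -- Radius and separation both scale with `G`, so the count does not depend on the spread of the
  -- points.
  have : 2 * (5 * G) * ((D : ℝ) + 1) / (ε * G / 8) = 80 * (D + 1) / ε := by
    field_simp; ring
  rw [this, add_div]
  gcongr
  rw [le_div_iff₀ hε]; linarith

lemma hypDist_eq (u v : PBall D) : hypDist u v = Real.arcosh (coshDist u.1 v.1) := rfl

lemma norm_PBall_lt (u : PBall D) : ‖u.1‖ < 1 := mem_ball_zero_iff.1 u.2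

lemma hypDist_le_hypDist_iff (u v u' v' : PBall D) :
    hypDist u v ≤ hypDist u' v' ↔ coshDist u.1 v.1 ≤ coshDist u'.1 v'.1 :=
  Real.arcosh_le_arcosh
    (one_pos.trans_le (one_le_coshDist (norm_PBall_lt u) (norm_PBall_lt v)))
    (one_pos.trans_le (one_le_coshDist (norm_PBall_lt u') (norm_PBall_lt v')))

lemma pointAt_fin (P : Fin n → PBall D) (i : Fin n) : pointAt P i = (P i).1 := by
  simp [pointAt]

/-- Take the selected point that covers the farthest point of `q`. The farthest point beats `a` and
`b`, as `coshDist_ge_of_close` demands. -/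
lemma IsGreedyNet.exists_hypDist_ge {a b : ℕ} {s : Memory} (hε : 0 < ε) (hε1 : ε ≤ 1) (ha : a < n)
    (hb : b < n) (h3 : 3 ≤ coshHalf (pointAt P a) (pointAt P b)) (h : IsGreedyNet P ε a b n s)
    {q p : PBall D} (hp : IsFarthestPoint P q p) :
    ∃ j, ∃ hj : j < s.nat 1 0, hypDist q p - ε ≤ hypDist q (P ⟨s.nat 2 j, h.lt j hj⟩) := by
  obtain ⟨⟨i, rfl⟩, hfar⟩ := hp
  obtain ⟨j, hj, hclose⟩ := h.cover i i.2
  have hle : ∀ l < n, coshDist q.1 (pointAt P l) ≤ coshDist q.1 (pointAt P i) := fun l hl => by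
    have := (hypDist_le_hypDist_iff _ _ _ _).1 (hfar ⟨l, hl⟩)
    rwa [← pointAt_fin, ← pointAt_fin] at this
  obtain ⟨h1, h2⟩ := coshDist_ge_of_close (norm_pointAt_lt P a) (norm_pointAt_lt P b)
    (norm_PBall_lt q) (norm_pointAt_lt P i) (norm_pointAt_lt P (s.nat 2 j)) (hle a ha) (hle b hb)
    ((not_far_iff hε.le a b _ _).1 hclose)
  refine ⟨j, hj, ?_⟩
  rw [hypDist_eq, hypDist_eq, ← pointAt_fin, ← pointAt_fin]
  exact arcosh_sub_le (h3.trans h2) (one_le_coshDist (norm_PBall_lt q) (norm_pointAt_lt P _)) hε.le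
    hε1 h1

end Coreset

/-! ### Main theorem. -/

theorem mainTheorem2 (D : ℕ) :
    ∃ (A : RealRAM.Prog) (C : ℝ),
      ∀ (n : ℕ) (hn : 0 < n) (P : Fin n → PBall D) (f : PBall D → PBall D),
        (∀ q, IsFarthestPoint P q (f q)) →
        5 ≤ hypDist (P ⟨0, hn⟩) (f (P ⟨0, hn⟩)) →
        ∀ ε : ℝ, 0 < ε → ε < 1 →
          ∃ (t : ℕ) (s : RealRAM.Memory) (k : ℕ) (Pε : Finset (PBall D)),
            RealRAM.Exec A (coresetInput P ε) t s ∧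
            (t : ℝ) ≤ C * (n / ε ^ D) ∧
            CoresetOutput P s k Pε ∧
            (k : ℝ) ≤ C * (1 / ε ^ D) ∧
            (Pε : Set (PBall D)) ⊆ Set.range P ∧
            (Pε.card : ℝ) ≤ C * (1 / ε ^ D) ∧
            ∀ q : PBall D, ∃ p ∈ Pε, hypDist q (f q) - ε ≤ hypDist q p := by
  classical
  set C₀ : ℝ := (80 * (D + 1) + 1) ^ D with hC₀
  have hC₀0 : 0 < C₀ := by positivity
  -- The summand in `C₀ + 1` pays for the `1` in `K + 1`, using `1 ≤ 1 / ε ^ D`.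
  refine ⟨coresetProg D, (stepBound D + 1) * (C₀ + 1), ?_⟩
  intro n hn P f hf h5 ε hε hε1
  have hpow : 0 < ε ^ D := by positivity
  have hone : 1 ≤ 1 / ε ^ D := by
    rw [le_div_iff₀ hpow, one_mul]; exact pow_le_one₀ hε.le hε1.le
  have hge : ∀ a, (∀ i < n, coshDist (pointAt P 0) (pointAt P i) ≤
      coshDist (pointAt P 0) (pointAt P a)) → 18 ≤ coshDist (pointAt P 0) (pointAt P a) := by
    intro a hfa
    obtain ⟨⟨i, hi⟩, -⟩ := hf (P ⟨0, hn⟩)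
    rw [← hi, hypDist_eq, ← pointAt_fin, ← pointAt_fin] at h5
    exact (eighteen_le_of_five_le_arcosh
      (one_le_coshDist (norm_pointAt_lt P _) (norm_pointAt_lt P _)) h5).trans (hfa i i.2)
  set K := ⌊C₀ * (1 / ε ^ D)⌋₊ with hKdef
  have hKle : (K : ℝ) ≤ C₀ * (1 / ε ^ D) := Nat.floor_le (by positivity)
  obtain ⟨t, s, hexec, ht, a, b, ha, hb, hfa, hfb, hk, hnet⟩ :=
    coresetProg_runs (P := P) (ε := ε) hn K fun a b m s _ hb hm hfa hfb hnet =>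
      Nat.le_floor (hnet.card_le hε hε1.le hb hm hfa hfb (by linarith [hge a hfa]))
  have hkC : (s.nat 1 0 : ℝ) ≤ (stepBound D + 1) * (C₀ + 1) * (1 / ε ^ D) := by
    calc (s.nat 1 0 : ℝ) ≤ K := by exact_mod_cast hk
      _ ≤ C₀ * (1 / ε ^ D) := hKle
      _ ≤ (stepBound D + 1) * (C₀ + 1) * (1 / ε ^ D) := by
        gcongr
        nlinarith [(Nat.cast_nonneg (stepBound D) : (0 : ℝ) ≤ stepBound D)]
  let idx : Fin (s.nat 1 0) → Fin n := fun j => ⟨s.nat 2 j, hnet.lt j j.2⟩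
  refine ⟨t, s, s.nat 1 0, Finset.univ.image (P ∘ idx), hexec, ?_, ⟨rfl, idx, fun _ => rfl, by
    rw [Finset.coe_image, Finset.coe_univ, Set.image_univ]⟩,
    hkC, ?_, ?_, ?_⟩
  · calc (t : ℝ) ≤ ((stepBound D * (n * (K + 1)) : ℕ) : ℝ) := by exact_mod_cast ht
      _ = stepBound D * (n * (K + 1)) := by push_cast; ring
      _ ≤ (stepBound D + 1) * (n * ((C₀ + 1) * (1 / ε ^ D))) := by
        gcongr
        · linarith
        · linarith
      _ = (stepBound D + 1) * (C₀ + 1) * (n / ε ^ D) := by ring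
  · simp only [Finset.coe_image, Finset.coe_univ, Set.image_univ]
    exact Set.range_comp_subset_range idx P
  · refine le_trans ?_ hkC
    exact_mod_cast Finset.card_image_le.trans (by simp)
  · intro q
    have h3 : 3 ≤ coshHalf (pointAt P a) (pointAt P b) := by
      -- Since `b` is at least as far from `a` as the first point is, `coshDist` of `a` and `b` is
      -- at least `18`, and `3 ^ 2 ≤ (1 + 18) / 2`.
      refine Real.le_sqrt_of_sq_le ?_
      have := hfb 0 hn
      rw [coshDist_comm] at this
      linarith [hge a hfa]
    obtain ⟨j, hj, h⟩ := hnet.exists_hypDist_ge hε hε1.le ha hb h3 (hf q)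
    exact ⟨_, Finset.mem_image.2 ⟨⟨j, hj⟩, Finset.mem_univ _, rfl⟩, h⟩
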